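/- **Setting.** Let $X=(X(t))_{t\in T}$ be a centred real-valued process, let $t_1,\dots,t_p\in T$ be deterministic points, and put $x=(X(t_1),\dots,X(t_p))^\top$. Let $X_1,\dots,X_n$ be independent copies of $X$, with observation vectors $x_i=(X_i(t_1),\dots,X_i(t_p))^\top$. Write $\|A\|=\mathrm{Tr}(AA^\top)^{1/2}$ for the Frobenius norm, $\Sigma=\mathbb E[xx^\top]$, $\Phi=V(\mathrm{vec}(xx^\top))$ (the covariance matrix of the vector $\mathrm{vec}(xx^\top)\in\mathbb R^{p^2}$), and $S=\frac1n\sum_{i=1}^n x_ix_i^\top$. Let $(g_\lambda)_{\lambda\in\Lambda}$ be real functions on $T$ and let $\mathcal M$ be a finite non-empty collection of finite subsets of $\Lambda$. For $m\in\mathcal M$ let $G_m\in\mathbb R^{p\times|m|}$ have entries $(G_m)_{j\lambda}=g_\lambda(t_j)$, and put $$\Pi_m=G_m(G_m^\top G_m)^-G_m^\top,\qquad D_m=\mathrm{Tr}(\Pi_m\otimes\Pi_m),\qquad \Sigma_m=\Pi_m\Sigma\Pi_m,$$ $$\widehat\Sigma_m=\Pi_mS\Pi_m,\qquad \delta_m^2=\frac{\mathrm{Tr}((\Pi_m\otimes\Pi_m)\Phi)}{D_m},$$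 where $A^-$ is a reflexive generalized inverse of $A$ ($AA^-A=A$, $A^-AA^-=A^-$). Assume $$C_{\inf}=\inf_{m\in\mathcal M}\mathrm{Tr}((\Pi_m\otimes\Pi_m)\Phi)>0,$$ so that all $D_m$ and $\delta_m^2$ are positive. With $y_i=\mathrm{vec}(x_ix_i^\top)$ and $S_{vec}=\frac1n\sum_{i=1}^n y_i$, set $$\widehat\Phi=\frac1n\sum_{i=1}^n\bigl(y_iy_i^\top-S_{vec}S_{vec}^\top\bigr),\qquad \widehat\delta_m^2=\frac{\mathrm{Tr}((\Pi_m\otimes\Pi_m)\widehat\Phi)}{D_m}.$$ For $\theta>0$ let $\widetilde\Sigma=\widehat\Sigma_{\widetilde m}$, where $\widetilde m$ is a (measurable) minimizer over $m\in\mathcal M$ of $$\frac1n\sum_{i=1}^n\|x_ix_i^\top-\widehat\Sigma_m\|^2+(1+\theta)\frac{\widehat\delta_m^2D_m}{n}.$$ **Theorem.** Let $0<q\le1$, and suppose that $\mathbb E\|xx^\top\|^\beta<\infty$ for some $\beta>\max(2(1+2q),3+2q)$. Then there are positive constants $C=C(\theta,\beta,q)$, $c=c(\theta,\beta,q)$,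 $C'(\theta,\kappa,q)$ and a threshold $n_0=n_0(\beta,\theta,C_{\inf},\Sigma)$, each depending only on the quantities displayed, such that for all $n\ge n_0$ one has $\mathbb E\|\Sigma-\widetilde\Sigma\|^{2q}<\infty$ and, for every $\kappa\in\,]2(1+2q),\min(\beta,2\beta-4)[$, $$\Bigl(\mathbb E\|\Sigma-\widetilde\Sigma\|^{2q}\Bigr)^{1/q}\le C\inf_{m\in\mathcal M}\Bigl(\|\Sigma-\Sigma_m\|^2+\frac{\delta_m^2D_m}{n}\Bigr)+\frac Cn\Bigl[\widetilde\Delta_\beta\Bigl(\mathbb E\bigl[\|xx^\top\|^\beta\bigr]^{2/\beta}+\|\Sigma\|^2\Bigr)+\delta_{\sup}^2\,\Delta_\kappa\Bigr],$$ where $$\widetilde\Delta_\beta^{\,q}=c(\theta,\beta,q)\Bigl(\mathbb E\|xx^\top\|^\beta\sum_{m\in\mathcal M}\delta_m^{-\beta}D_m^{-\beta/2}\Bigr)^{1-2q/\kappa},$$ $$\Delta_\kappa^{\,q}=C'(\theta,\kappa,q)\,\mathbb E\|xx^\top\|^\kappa\sum_{m\in\mathcal M}\delta_m^{-\kappa}D_m^{-(\kappa/2-1-q)},\qquad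 \delta_{\sup}^2=\max_{m\in\mathcal M}\delta_m^2.$$ -/

import Mathlib

open MeasureTheory ProbabilityTheory
open scoped Matrix Kronecker

noncomputable section

namespace CovSelection

/-- The Frobenius norm `‖A‖`, given by `‖A‖² = Tr (A Aᵀ)`. -/
def frobNorm {ι κ : Type*} [Fintype ι] [Fintype κ] (A : Matrix ι κ ℝ) : ℝ :=
  Real.sqrt (Matrix.trace (A * Aᵀ))

/-- `B` is a reflexive generalized inverse of `A`. Every such inverse is allowed. -/
def IsReflexiveGenInverse {ι : Type*} [Fintype ι] (A B : Matrix ι ι ℝ) : Prop :=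
  A * B * A = A ∧ B * A * B = B

section Models

variable {T Λ : Type*} {p : ℕ}

/-- The vector `(X (t₁), …, X (t_p))` of the values of a process at the observation points. -/
def obs {Ω : Type*} (t : Fin p → T) (X : T → Ω → ℝ) (ω : Ω) : Fin p → ℝ :=
  fun j => X (t j) ω

/-- The matrix `G_m`, with entries `g_lam (t_j)` for `1 ≤ j ≤ p` and `lam ∈ m`. -/
def designMatrix (g : Λ → T → ℝ) (t : Fin p → T) (m : Finset Λ) : Matrix (Fin p) m ℝ :=
  Matrix.of fun j l => g l (t j)

/-- The matrix `Π_m = G_m (G_mᵀ G_m)⁻ G_mᵀ`, where `H` is the generalized inverse of `G_mᵀ G_m`. -/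
def projMatrix (g : Λ → T → ℝ) (t : Fin p → T) (m : Finset Λ) (H : Matrix m m ℝ) :
    Matrix (Fin p) (Fin p) ℝ :=
  designMatrix g t m * H * (designMatrix g t m)ᵀ

end Models

variable {p n : ℕ}

/-- `D_m = Tr (Π_m ⊗ Π_m)`. -/
def modelDim (Pm : Matrix (Fin p) (Fin p) ℝ) : ℝ :=
  Matrix.trace (Pm ⊗ₖ Pm)

/-- `Tr ((Π_m ⊗ Π_m) Ψ)`. -/
def projTrace (Pm : Matrix (Fin p) (Fin p) ℝ)
    (Psi : Matrix (Fin p × Fin p) (Fin p × Fin p) ℝ) : ℝ :=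
  Matrix.trace ((Pm ⊗ₖ Pm) * Psi)

/-- `Tr ((Π_m ⊗ Π_m) Ψ) / D_m`: this is `δ_m²` for `Ψ = Φ`, and its estimator for the empirical
version of `Φ`. -/
def deltaSq (Pm : Matrix (Fin p) (Fin p) ℝ)
    (Psi : Matrix (Fin p × Fin p) (Fin p × Fin p) ℝ) : ℝ :=
  projTrace Pm Psi / modelDim Pm

/-- The matrix `v vᵀ`. -/
def outer (v : Fin p → ℝ) : Matrix (Fin p) (Fin p) ℝ :=
  Matrix.vecMulVec v v

/-- The vector `vec (v vᵀ)`. -/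
def yvec (v : Fin p → ℝ) : Fin p × Fin p → ℝ :=
  Matrix.vec (outer v)

section Population

variable {Ω : Type*} [MeasurableSpace Ω]

/-- `Σ = E (x xᵀ)`. -/
def covMatrix (P : Measure Ω) (x : Ω → Fin p → ℝ) : Matrix (Fin p) (Fin p) ℝ :=
  Matrix.of fun j k => ∫ ω, x ω j * x ω k ∂P

/-- `Φ = V (vec (x xᵀ))`, the covariance matrix of the vector `vec (x xᵀ)`. -/
def phiMatrix (P : Measure Ω) (x : Ω → Fin p → ℝ) :
    Matrix (Fin p × Fin p) (Fin p × Fin p) ℝ :=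
  Matrix.of fun a b => covariance (fun ω => yvec (x ω) a) (fun ω => yvec (x ω) b) P

/-- The moment `E ‖x xᵀ‖ ^ r`. -/
def moment (P : Measure Ω) (x : Ω → Fin p → ℝ) (r : ℝ) : ℝ :=
  ∫ ω, frobNorm (outer (x ω)) ^ r ∂P

end Population

/-- The empirical covariance matrix `S = (1/n) ∑ xᵢ xᵢᵀ`. -/
def empCov (x : Fin n → Fin p → ℝ) : Matrix (Fin p) (Fin p) ℝ :=
  (1 / (n : ℝ)) • ∑ i, outer (x i)

/-- The estimator `Π_m S Π_m`. -/
def projEstimator (x : Fin n → Fin p → ℝ) (Pm : Matrix (Fin p) (Fin p) ℝ) :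
    Matrix (Fin p) (Fin p) ℝ :=
  Pm * empCov x * Pm

/-- The empirical mean `S_vec` of the vectors `yᵢ = vec (xᵢ xᵢᵀ)`. -/
def sVec (x : Fin n → Fin p → ℝ) : Fin p × Fin p → ℝ :=
  (1 / (n : ℝ)) • ∑ i, yvec (x i)

/-- The estimator `(1/n) ∑ (yᵢ yᵢᵀ - S_vec S_vecᵀ)` of `Φ`. -/
def phiHat (x : Fin n → Fin p → ℝ) : Matrix (Fin p × Fin p) (Fin p × Fin p) ℝ :=
  (1 / (n : ℝ)) • ∑ i,
    (Matrix.vecMulVec (yvec (x i)) (yvec (x i)) - Matrix.vecMulVec (sVec x) (sVec x))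

/-- The data-driven penalty `(1 + θ) (δ̂_m)² D_m / n`. -/
def penHat (θ : ℝ) (x : Fin n → Fin p → ℝ) (Pm : Matrix (Fin p) (Fin p) ℝ) : ℝ :=
  (1 + θ) * (deltaSq Pm (phiHat x) * modelDim Pm / n)

/-- The penalized empirical risk `(1/n) ∑ ‖xᵢ xᵢᵀ - Π_m S Π_m‖² + penHat`. -/
def penCrit (θ : ℝ) (x : Fin n → Fin p → ℝ) (Pm : Matrix (Fin p) (Fin p) ℝ) : ℝ :=
  (1 / (n : ℝ)) * ∑ i, frobNorm (outer (x i) - projEstimator x Pm) ^ 2 + penHat θ x Pm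

/-- The risk bound `‖Σ - Σ_m‖² + δ_m² D_m / n` of one model, with `Σ_m = Π_m Σ Π_m`. -/
def oracleRisk (n : ℕ) (Sig : Matrix (Fin p) (Fin p) ℝ)
    (Phi : Matrix (Fin p × Fin p) (Fin p × Fin p) ℝ) (Pm : Matrix (Fin p) (Fin p) ℝ) : ℝ :=
  frobNorm (Sig - Pm * Sig * Pm) ^ 2 + deltaSq Pm Phi * modelDim Pm / n

section Remainders

variable {ι : Type*}

/-- The term `Δ̃_β`, given by
`Δ̃_β ^ q = c (E ‖x xᵀ‖ ^ β ∑_m δ_m ^ (-β) D_m ^ (-β/2)) ^ (1 - 2q/κ)`;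
here `mom` stands for `E ‖x xᵀ‖ ^ β` and `Pm m` for `Π_m`. -/
def deltaTilde (c β κ q mom : ℝ) (M : Finset ι) (Pm : ι → Matrix (Fin p) (Fin p) ℝ)
    (Phi : Matrix (Fin p × Fin p) (Fin p × Fin p) ℝ) : ℝ :=
  (c * (mom * ∑ m ∈ M,
    Real.sqrt (deltaSq (Pm m) Phi) ^ (-β) * modelDim (Pm m) ^ (-(β / 2))) ^ (1 - 2 * q / κ)) ^ (1 / q)

/-- The term `Δ_κ`, given by
`Δ_κ ^ q = C' E ‖x xᵀ‖ ^ κ ∑_m δ_m ^ (-κ) D_m ^ (-(κ/2 - 1 - q))`;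
here `mom` stands for `E ‖x xᵀ‖ ^ κ` and `Pm m` for `Π_m`. -/
def deltaKappa (C' κ q mom : ℝ) (M : Finset ι) (Pm : ι → Matrix (Fin p) (Fin p) ℝ)
    (Phi : Matrix (Fin p × Fin p) (Fin p × Fin p) ℝ) : ℝ :=
  (C' * mom * ∑ m ∈ M,
    Real.sqrt (deltaSq (Pm m) Phi) ^ (-κ) * modelDim (Pm m) ^ (-(κ / 2 - 1 - q))) ^ (1 / q)

end Remainders

end CovSelection

end

/-!
Write `E = S - Σ` for the noise and `R = ‖Σ - Σ̃‖` for the loss. Two observations carry the proof.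

*The penalty is non-negative*, because the estimator of `Φ` is an empirical covariance matrix and
`Π_m` is an orthogonal projection. Up to a term that does not depend on the model, the criterion is
`‖S - Π_m S Π_m‖²` plus the penalty, so the minimality of the selected model gives, for every fixed
model `m₀` and at every sample point,
`R² ≤ 6 ‖E‖² + 4 ‖Σ - Σ_{m₀}‖² + 2 penHat(m₀)`, where `penHat(m₀)` is at most `(1 + θ) / n` times
the empirical mean of `‖xᵢ xᵢᵀ‖²` (`frobNorm_sub_selected_sq_le`). By independence
`E ‖E‖² ≤ E ‖x xᵀ‖² / n` (`integral_frobNorm_empCov_sub_sq_le`). Hence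
`E R² ≤ 4 ‖Σ - Σ_{m₀}‖² + (8 + 2θ) E ‖x xᵀ‖² / n`, and Jensen's inequality with `q ≤ 1` passes to
`(E R^{2q})^{1/q} ≤ E R²`.

*The remainder `δ_sup² Δ_κ` is at least `E ‖x xᵀ‖²`*, already with the constant `C' = 1`
(`le_deltaSq_mul_deltaKappa`). Indeed `δ_m² D_m = Tr ((Π_m ⊗ Π_m) Φ) ≤ E ‖x xᵀ‖²` for every model
(`projTrace_phiMatrix_le`), `D_m ≥ 1` because `D_m` is the trace of a non-zero projection
(`one_le_modelDim`), and `E ‖x xᵀ‖ ^ κ ≥ (E ‖x xᵀ‖²) ^ (κ/2)`.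

Taking for `m₀` the model that attains the infimum of the risk bound, the bias is absorbed by that
infimum and the term `E ‖x xᵀ‖² / n` by the remainder. No concentration of the estimated penalty is
needed, so the inequality holds for all `n ≥ 1`, and the non-negative term with `Δ̃_β` is free.
-/

namespace CovSelection

/-! ### Frobenius norm -/

section Deterministic

lemma frobNorm_nonneg {ι κ : Type*} [Fintype ι] [Fintype κ] (A : Matrix ι κ ℝ) :
    0 ≤ frobNorm A :=
  Real.sqrt_nonneg _

lemma frobNorm_sq {ι κ : Type*} [Fintype ι] [Fintype κ] (A : Matrix ι κ ℝ) :
    frobNorm A ^ 2 = ∑ i, ∑ j, A i j ^ 2 := by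
  have h : Matrix.trace (A * Aᵀ) = ∑ i, ∑ j, A i j ^ 2 := by
    simp [Matrix.trace, Matrix.mul_apply, sq]
  rw [frobNorm, Real.sq_sqrt, h]
  rw [h]
  positivity

lemma frobNorm_sq_eq_vec {ι κ : Type*} [Fintype ι] [Fintype κ] (A : Matrix ι κ ℝ) :
    frobNorm A ^ 2 = A.vec ⬝ᵥ A.vec := by
  rw [frobNorm_sq, Finset.sum_comm]
  simp [dotProduct, Fintype.sum_prod_type, Matrix.vec, sq]

lemma frobNorm_add_sq_le {ι κ : Type*} [Fintype ι] [Fintype κ] (A B : Matrix ι κ ℝ) :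
    frobNorm (A + B) ^ 2 ≤ 2 * frobNorm A ^ 2 + 2 * frobNorm B ^ 2 := by
  simp only [frobNorm_sq, Finset.mul_sum, ← Finset.sum_add_distrib, Matrix.add_apply]
  gcongr with i _ j _
  linarith [sq_nonneg (A i j - B i j)]

lemma frobNorm_neg_sq {ι κ : Type*} [Fintype ι] [Fintype κ] (A : Matrix ι κ ℝ) :
    frobNorm (-A) ^ 2 = frobNorm A ^ 2 := by
  simp [frobNorm_sq]

lemma yvec_dotProduct_self {p : ℕ} (v : Fin p → ℝ) :
    yvec v ⬝ᵥ yvec v = frobNorm (outer v) ^ 2 :=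
  (frobNorm_sq_eq_vec _).symm

lemma frobNorm_outer {p : ℕ} (v : Fin p → ℝ) : frobNorm (outer v) = ∑ j, v j ^ 2 := by
  have h : frobNorm (outer v) ^ 2 = (∑ j, v j ^ 2) ^ 2 := by
    rw [frobNorm_sq, sq (∑ j, v j ^ 2), Finset.sum_mul_sum]
    simp [outer, Matrix.vecMulVec_apply, mul_pow]
  exact (pow_left_inj₀ (frobNorm_nonneg _) (by positivity) two_ne_zero).1 h

/-! ### Orthogonal projections -/

/-- `Π = G (Gᵀ G)⁻ Gᵀ` satisfies `Π G = G`, which makes it a symmetric idempotent even when the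
generalized inverse `(Gᵀ G)⁻` is not symmetric. -/
lemma projMatrix_isProj {T Λ : Type*} {p : ℕ} (g : Λ → T → ℝ) (t : Fin p → T) (m : Finset Λ)
    (H : Matrix m m ℝ)
    (hH : IsReflexiveGenInverse ((designMatrix g t m)ᵀ * designMatrix g t m) H) :
    (projMatrix g t m H)ᵀ = projMatrix g t m H ∧
      projMatrix g t m H * projMatrix g t m H = projMatrix g t m H := by
  classical
  unfold projMatrix
  set G := designMatrix g t m
  have hG : G * H * Gᵀ * G = G := by
    have h0 : Gᴴ * G * (H * (Gᵀ * G) - 1) = 0 := by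
      rw [Matrix.conjTranspose_eq_transpose_of_trivial, Matrix.mul_sub, ← Matrix.mul_assoc, hH.1,
        Matrix.mul_one, sub_self]
    have h1 := (Matrix.conjTranspose_mul_self_mul_eq_zero G _).1 h0
    rw [Matrix.mul_sub, Matrix.mul_one, sub_eq_zero] at h1
    simpa only [Matrix.mul_assoc] using h1
  have hi : G * H * Gᵀ * (G * H * Gᵀ) = G * H * Gᵀ := by
    rw [← Matrix.mul_assoc, ← Matrix.mul_assoc, hG]
  refine ⟨?_, hi⟩
  have hT : Gᵀ * (G * H * Gᵀ)ᵀ = Gᵀ := by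
    rw [← Matrix.transpose_mul, hG]
  -- `Π Πᵀ = Π`, and the left-hand side is symmetric
  have hs : G * H * Gᵀ * (G * H * Gᵀ)ᵀ = G * H * Gᵀ := by
    rw [Matrix.mul_assoc (G * H), hT]
  calc (G * H * Gᵀ)ᵀ = (G * H * Gᵀ * (G * H * Gᵀ)ᵀ)ᵀ := by rw [hs]
    _ = G * H * Gᵀ * (G * H * Gᵀ)ᵀ := by rw [Matrix.transpose_mul, Matrix.transpose_transpose]
    _ = _ := hs

section Proj

variable {ι : Type*} [Fintype ι] {W : Matrix ι ι ℝ}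

lemma dotProduct_mulVec_eq_of_proj (hs : Wᵀ = W) (hi : W * W = W) (y : ι → ℝ) :
    y ⬝ᵥ W *ᵥ y = (W *ᵥ y) ⬝ᵥ (W *ᵥ y) := by
  conv_rhs => rw [Matrix.dotProduct_mulVec, ← Matrix.mulVec_transpose, hs, Matrix.mulVec_mulVec,
    hi, dotProduct_comm]

lemma dotProduct_self_nonneg' (y : ι → ℝ) : 0 ≤ y ⬝ᵥ y :=
  Finset.sum_nonneg fun i _ => mul_self_nonneg (y i)

lemma dotProduct_mulVec_nonneg_of_proj (hs : Wᵀ = W) (hi : W * W = W) (y : ι → ℝ) :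
    0 ≤ y ⬝ᵥ W *ᵥ y := by
  rw [dotProduct_mulVec_eq_of_proj hs hi]
  exact dotProduct_self_nonneg' _

lemma dotProduct_sub_mulVec_self (hs : Wᵀ = W) (hi : W * W = W) (y : ι → ℝ) :
    (y - W *ᵥ y) ⬝ᵥ (y - W *ᵥ y) = y ⬝ᵥ y - y ⬝ᵥ W *ᵥ y := by
  simp only [sub_dotProduct, dotProduct_sub]
  rw [← dotProduct_mulVec_eq_of_proj hs hi, dotProduct_comm (W *ᵥ y) y]
  ring

lemma dotProduct_mulVec_le_of_proj (hs : Wᵀ = W) (hi : W * W = W) (y : ι → ℝ) :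
    y ⬝ᵥ W *ᵥ y ≤ y ⬝ᵥ y := by
  have := dotProduct_self_nonneg' (y - W *ᵥ y)
  rw [dotProduct_sub_mulVec_self hs hi] at this
  linarith

lemma trace_mul_vecMulVec_self (W : Matrix ι ι ℝ) (v : ι → ℝ) :
    Matrix.trace (W * Matrix.vecMulVec v v) = v ⬝ᵥ W *ᵥ v := by
  rw [Matrix.mul_vecMulVec, Matrix.trace_vecMulVec, dotProduct_comm]

/-- The trace of a non-zero orthogonal projection `W` is at least `1`: it is the sum of the squared
entries of `W`, which bounds the ratio `|W u|² / |u|² = 1` for `u ≠ 0` in the range of `W`. -/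
lemma one_le_trace_of_proj (hs : Wᵀ = W) (hi : W * W = W) (h0 : W ≠ 0) : 1 ≤ W.trace := by
  classical
  have htr : W.trace = ∑ i, ∑ j, W i j ^ 2 := by
    conv_lhs => rw [← hi]
    refine Finset.sum_congr rfl fun i _ => ?_
    rw [Matrix.diag_apply, Matrix.mul_apply]
    refine Finset.sum_congr rfl fun j _ => ?_
    rw [sq, ← Matrix.transpose_apply W i j, hs]
  obtain ⟨v, hv⟩ : ∃ v, W *ᵥ v ≠ 0 := by
    by_contra! h
    exact h0 (Matrix.ext_of_mulVec_single fun i => by rw [h, Matrix.zero_mulVec])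
  set u := W *ᵥ v with hu
  have hWu : W *ᵥ u = u := by rw [hu, Matrix.mulVec_mulVec, hi]
  have hpos : 0 < u ⬝ᵥ u :=
    lt_of_le_of_ne (dotProduct_self_nonneg' u) fun h => hv (dotProduct_self_eq_zero.1 h.symm)
  have hle : u ⬝ᵥ u ≤ W.trace * (u ⬝ᵥ u) := by
    calc u ⬝ᵥ u = ∑ i, (W *ᵥ u) i ^ 2 := by rw [hWu]; simp [dotProduct, sq]
      _ ≤ ∑ i, (∑ j, W i j ^ 2) * (u ⬝ᵥ u) := by
        refine Finset.sum_le_sum fun i _ => ?_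
        have := Finset.sum_mul_sq_le_sq_mul_sq Finset.univ (W i) u
        simpa [Matrix.mulVec, dotProduct, sq] using this
      _ = _ := by rw [htr, Finset.sum_mul]
  nlinarith

end Proj

variable {p n : ℕ} {Pm : Matrix (Fin p) (Fin p) ℝ}

lemma kronecker_self_isProj (hs : Pmᵀ = Pm) (hi : Pm * Pm = Pm) :
    (Pm ⊗ₖ Pm)ᵀ = Pm ⊗ₖ Pm ∧ (Pm ⊗ₖ Pm) * (Pm ⊗ₖ Pm) = Pm ⊗ₖ Pm := by
  refine ⟨?_, ?_⟩
  · rw [← Matrix.kroneckerMap_transpose, hs]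
  · rw [← Matrix.mul_kronecker_mul, hi]

lemma frobNorm_sub_proj_sq_le (hs : Pmᵀ = Pm) (hi : Pm * Pm = Pm)
    (A : Matrix (Fin p) (Fin p) ℝ) : frobNorm (A - Pm * A * Pm) ^ 2 ≤ frobNorm A ^ 2 := by
  have hW := kronecker_self_isProj hs hi
  have hv : (A - Pm * A * Pm).vec = A.vec - (Pm ⊗ₖ Pm) *ᵥ A.vec := by
    rw [Matrix.kronecker_mulVec_vec, hs, Matrix.vec_sub]
  rw [frobNorm_sq_eq_vec, frobNorm_sq_eq_vec, hv, dotProduct_sub_mulVec_self hW.1 hW.2]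
  linarith [dotProduct_mulVec_nonneg_of_proj hW.1 hW.2 A.vec]

/-- A model with `Tr ((Π_m ⊗ Π_m) Φ) > 0` has dimension `D_m ≥ 1`. -/
lemma one_le_modelDim (hs : Pmᵀ = Pm) (hi : Pm * Pm = Pm)
    {Psi : Matrix (Fin p × Fin p) (Fin p × Fin p) ℝ} (h : 0 < projTrace Pm Psi) :
    1 ≤ modelDim Pm := by
  have hW := kronecker_self_isProj hs hi
  refine one_le_trace_of_proj hW.1 hW.2 fun h0 => ?_
  simp [projTrace, h0] at h

/-! ### The penalized criterion -/

lemma projTrace_phiHat (Pm : Matrix (Fin p) (Fin p) ℝ) (x : Fin n → Fin p → ℝ) :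
    projTrace Pm (phiHat x) = (1 / (n : ℝ)) * ∑ i,
      (yvec (x i) ⬝ᵥ (Pm ⊗ₖ Pm) *ᵥ yvec (x i) - sVec x ⬝ᵥ (Pm ⊗ₖ Pm) *ᵥ sVec x) := by
  simp only [projTrace, phiHat, Matrix.mul_smul, Matrix.trace_smul, Matrix.mul_sum,
    Matrix.trace_sum, Matrix.mul_sub, Matrix.trace_sub, trace_mul_vecMulVec_self, smul_eq_mul]

/-- By the Cauchy–Schwarz inequality in each coordinate, the estimator of `Φ` has non-negative total
variance along a projection. -/
lemma projTrace_phiHat_nonneg (hs : Pmᵀ = Pm) (hi : Pm * Pm = Pm) (x : Fin n → Fin p → ℝ) :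
    0 ≤ projTrace Pm (phiHat x) := by
  have hW := kronecker_self_isProj hs hi
  rw [projTrace_phiHat]
  set W := Pm ⊗ₖ Pm
  refine mul_nonneg (by positivity) ?_
  rcases Nat.eq_zero_or_pos n with rfl | hn
  · simp
  have hn' : (0 : ℝ) < n := by exact_mod_cast hn
  have hmean : ∀ c, (W *ᵥ sVec x) c = (1 / (n : ℝ)) * ∑ i, (W *ᵥ yvec (x i)) c := fun c => by
    simp [sVec, Matrix.mulVec_smul, Matrix.mulVec_sum]
  simp only [dotProduct_mulVec_eq_of_proj hW.1 hW.2, Finset.sum_sub_distrib]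
  simp only [dotProduct]
  rw [Finset.sum_comm]
  simp only [Finset.sum_const, Finset.card_univ, Fintype.card_fin, nsmul_eq_mul, Finset.mul_sum,
    ← Finset.sum_sub_distrib]
  refine Finset.sum_nonneg fun c _ => ?_
  have hcs := sq_sum_le_card_mul_sum_sq (s := Finset.univ) (f := fun i => (W *ᵥ yvec (x i)) c)
  rw [hmean]
  simp only [Finset.card_univ, Fintype.card_fin, sq] at hcs
  have : (n : ℝ) * (1 / (n : ℝ) * (∑ i, (W *ᵥ yvec (x i)) c) *
      (1 / (n : ℝ) * ∑ i, (W *ᵥ yvec (x i)) c)) =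
      ((∑ i, (W *ᵥ yvec (x i)) c) * ∑ i, (W *ᵥ yvec (x i)) c) / n := by
    field_simp
  rw [this, sub_nonneg, div_le_iff₀ hn']
  linarith

lemma projTrace_phiHat_le (hs : Pmᵀ = Pm) (hi : Pm * Pm = Pm) (x : Fin n → Fin p → ℝ) :
    projTrace Pm (phiHat x) ≤ (1 / (n : ℝ)) * ∑ i, frobNorm (outer (x i)) ^ 2 := by
  have hW := kronecker_self_isProj hs hi
  rw [projTrace_phiHat]
  gcongr with i
  rw [← yvec_dotProduct_self]
  linarith [dotProduct_mulVec_le_of_proj hW.1 hW.2 (yvec (x i)),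
    dotProduct_mulVec_nonneg_of_proj hW.1 hW.2 (sVec x)]

lemma deltaSq_mul_modelDim (Psi : Matrix (Fin p × Fin p) (Fin p × Fin p) ℝ)
    (h : 1 ≤ modelDim Pm) : deltaSq Pm Psi * modelDim Pm = projTrace Pm Psi :=
  div_mul_cancel₀ _ (by linarith)

/-- Only `‖S - Π_m S Π_m‖²` and the penalty depend on the model in the criterion. -/
lemma penCrit_eq (θ : ℝ) (hn : 0 < n) (x : Fin n → Fin p → ℝ) (Pm : Matrix (Fin p) (Fin p) ℝ) :
    penCrit θ x Pm = (1 / (n : ℝ)) * ∑ i, frobNorm (outer (x i) - empCov x) ^ 2 +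
      frobNorm (empCov x - projEstimator x Pm) ^ 2 + penHat θ x Pm := by
  have hn' : (n : ℝ) ≠ 0 := by exact_mod_cast hn.ne'
  rw [penCrit]
  congr 1
  have hent : ∀ j k, ∑ i, outer (x i) j k = n * empCov x j k := fun j k => by
    simp [empCov, Matrix.sum_apply, hn']
  set A := projEstimator x Pm
  have key : ∑ i, frobNorm (outer (x i) - A) ^ 2 =
      ∑ i, frobNorm (outer (x i) - empCov x) ^ 2 + n * frobNorm (empCov x - A) ^ 2 := by
    simp only [frobNorm_sq, Matrix.sub_apply]
    rw [Finset.sum_comm, Finset.sum_comm (s := Finset.univ (α := Fin n)), Finset.mul_sum,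
      ← Finset.sum_add_distrib]
    refine Finset.sum_congr rfl fun j _ => ?_
    rw [Finset.sum_comm, Finset.sum_comm (s := Finset.univ (α := Fin n)), Finset.mul_sum,
      ← Finset.sum_add_distrib]
    refine Finset.sum_congr rfl fun k _ => ?_
    have h1 : ∀ i, (outer (x i) j k - A j k) ^ 2 = (outer (x i) j k - empCov x j k) ^ 2 +
        2 * (empCov x j k - A j k) * outer (x i) j k -
        2 * (empCov x j k - A j k) * empCov x j k + (empCov x j k - A j k) ^ 2 := fun i => by ring
    simp only [h1, Finset.sum_add_distrib, Finset.sum_sub_distrib, ← Finset.mul_sum, hent]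
    simp
  rw [key]
  field_simp

/-- The pathwise comparison with a fixed model: the squared loss of the selected estimator is at
most a multiple of the noise, the bias of the model, and its penalty. -/
lemma frobNorm_sub_selected_sq_le {θ : ℝ} (hθ : 0 < θ) (hn : 0 < n) (x : Fin n → Fin p → ℝ)
    (Sig : Matrix (Fin p) (Fin p) ℝ) {Q : Matrix (Fin p) (Fin p) ℝ}
    (hs : Pmᵀ = Pm) (hi : Pm * Pm = Pm) (hD : 1 ≤ modelDim Pm)
    (hQs : Qᵀ = Q) (hQi : Q * Q = Q) (hQD : 1 ≤ modelDim Q)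
    (hcrit : penCrit θ x Q ≤ penCrit θ x Pm) :
    frobNorm (Sig - projEstimator x Q) ^ 2 ≤ 6 * frobNorm (empCov x - Sig) ^ 2 +
      4 * frobNorm (Sig - Pm * Sig * Pm) ^ 2 +
      2 * ((1 + θ) * ((1 / (n : ℝ)) * (∑ i, frobNorm (outer (x i)) ^ 2) / n)) := by
  have hpen0 : 0 ≤ penHat θ x Q := by
    have := projTrace_phiHat_nonneg hQs hQi x
    rw [penHat, deltaSq_mul_modelDim _ hQD]
    positivity
  have hpen : penHat θ x Pm ≤
      (1 + θ) * ((1 / (n : ℝ)) * (∑ i, frobNorm (outer (x i)) ^ 2) / n) := by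
    rw [penHat, deltaSq_mul_modelDim _ hD]
    gcongr
    exact projTrace_phiHat_le hs hi x
  rw [penCrit_eq θ hn, penCrit_eq θ hn] at hcrit
  have h1 : frobNorm (Sig - projEstimator x Q) ^ 2 ≤ 2 * frobNorm (empCov x - Sig) ^ 2 +
      2 * frobNorm (empCov x - projEstimator x Q) ^ 2 := by
    have := frobNorm_add_sq_le (-(empCov x - Sig)) (empCov x - projEstimator x Q)
    rw [frobNorm_neg_sq] at this
    convert this using 3
    abel
  have h2 : frobNorm (empCov x - projEstimator x Pm) ^ 2 ≤
      2 * frobNorm (Sig - Pm * Sig * Pm) ^ 2 + 2 * frobNorm (empCov x - Sig) ^ 2 := by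
    have h3 := frobNorm_add_sq_le (Sig - Pm * Sig * Pm)
      ((empCov x - Sig) - Pm * (empCov x - Sig) * Pm)
    have h4 := frobNorm_sub_proj_sq_le hs hi (empCov x - Sig)
    have h5 : empCov x - projEstimator x Pm = (Sig - Pm * Sig * Pm) +
        ((empCov x - Sig) - Pm * (empCov x - Sig) * Pm) := by
      rw [projEstimator, Matrix.mul_sub, Matrix.sub_mul]
      abel
    rw [h5]
    linarith
  linarith

end Deterministic

/-! ### Moments of the observations -/

section Moments

variable {Ω : Type*} [MeasurableSpace Ω] {P : Measure Ω} {p : ℕ} {x : Ω → Fin p → ℝ}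

lemma measurable_outer_apply (j k : Fin p) :
    Measurable fun v : Fin p → ℝ => outer v j k := by
  simp only [outer, Matrix.vecMulVec_apply]
  fun_prop

lemma measurable_frobNorm_outer : Measurable fun v : Fin p → ℝ => frobNorm (outer v) := by
  simp only [frobNorm_outer]
  fun_prop

lemma integrable_frobNorm_rpow [IsFiniteMeasure P] (hx : AEMeasurable x P) {β r : ℝ}
    (hβ : Integrable (fun ω => frobNorm (outer (x ω)) ^ β) P) (hr : 0 ≤ r) (hrβ : r ≤ β) :
    Integrable (fun ω => frobNorm (outer (x ω)) ^ r) P := by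
  refine ((integrable_const (1 : ℝ)).add hβ).mono'
    ((measurable_frobNorm_outer.comp_aemeasurable hx).pow_const r).aestronglyMeasurable ?_
  refine Filter.Eventually.of_forall fun ω => ?_
  have h0 := frobNorm_nonneg (outer (x ω))
  rw [Real.norm_of_nonneg (by positivity), Pi.add_apply]
  rcases le_total (frobNorm (outer (x ω))) 1 with h | h
  · linarith [Real.rpow_le_one h0 h hr, Real.rpow_nonneg h0 β]
  · linarith [Real.rpow_le_rpow_of_exponent_le h hrβ]

lemma abs_outer_apply_le (v : Fin p → ℝ) (j k : Fin p) : |outer v j k| ≤ frobNorm (outer v) := by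
  refine abs_le_of_sq_le_sq ?_ (frobNorm_nonneg _)
  rw [frobNorm_sq]
  exact (Finset.single_le_sum (f := fun b => outer v j b ^ 2) (fun _ _ => sq_nonneg _)
    (Finset.mem_univ k)).trans (Finset.single_le_sum (f := fun a => ∑ b, outer v a b ^ 2)
      (fun _ _ => Finset.sum_nonneg fun _ _ => sq_nonneg _) (Finset.mem_univ j))

lemma memLp_outer_apply (hx : AEMeasurable x P)
    (h2 : Integrable (fun ω => frobNorm (outer (x ω)) ^ 2) P) (j k : Fin p) :
    MemLp (fun ω => outer (x ω) j k) 2 P := by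
  have hm : AEMeasurable (fun ω => outer (x ω) j k) P :=
    (measurable_outer_apply j k).comp_aemeasurable hx
  rw [memLp_two_iff_integrable_sq hm.aestronglyMeasurable]
  refine h2.mono' (hm.pow_const 2).aestronglyMeasurable (Filter.Eventually.of_forall fun ω => ?_)
  rw [Real.norm_of_nonneg (sq_nonneg _), ← sq_abs]
  exact pow_le_pow_left₀ (abs_nonneg _) (abs_outer_apply_le _ j k) 2

lemma covMatrix_apply (P : Measure Ω) (x : Ω → Fin p → ℝ) (j k : Fin p) :
    covMatrix P x j k = ∫ ω, outer (x ω) j k ∂P := by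
  simp [covMatrix, outer, Matrix.vecMulVec_apply]

/-- `Tr ((Π ⊗ Π) Φ)` is the total variance of `Π x xᵀ Π`, hence at most `E ‖x xᵀ‖²`. -/
lemma projTrace_phiMatrix_le [IsProbabilityMeasure P] (hx : AEMeasurable x P)
    (h2 : Integrable (fun ω => frobNorm (outer (x ω)) ^ 2) P) {Pm : Matrix (Fin p) (Fin p) ℝ}
    (hs : Pmᵀ = Pm) (hi : Pm * Pm = Pm) :
    projTrace Pm (phiMatrix P x) ≤ ∫ ω, frobNorm (outer (x ω)) ^ 2 ∂P := by
  have hW := kronecker_self_isProj hs hi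
  have hy : ∀ a, MemLp (fun ω => yvec (x ω) a) 2 P := fun a => memLp_outer_apply hx h2 a.2 a.1
  have hint : ∀ a b, Integrable (fun ω => yvec (x ω) b * (Pm ⊗ₖ Pm) b a * yvec (x ω) a) P :=
    fun a b => by
      have := ((hy b).integrable_mul (hy a)).const_mul ((Pm ⊗ₖ Pm) b a)
      refine this.congr (Filter.Eventually.of_forall fun ω => ?_)
      simp only [Pi.mul_apply]
      ring
  set μ : Fin p × Fin p → ℝ := fun a => ∫ ω, yvec (x ω) a ∂P
  have hquad : ∀ y : Fin p × Fin p → ℝ, y ⬝ᵥ (Pm ⊗ₖ Pm) *ᵥ y =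
      ∑ b, ∑ a, y b * (Pm ⊗ₖ Pm) b a * y a := fun y => by
    simp [dotProduct, Matrix.mulVec, Finset.mul_sum, mul_assoc]
  have hE : projTrace Pm (phiMatrix P x) =
      ∫ ω, yvec (x ω) ⬝ᵥ (Pm ⊗ₖ Pm) *ᵥ yvec (x ω) ∂P - μ ⬝ᵥ (Pm ⊗ₖ Pm) *ᵥ μ := by
    simp only [hquad]
    rw [integral_finsetSum _ fun b _ => integrable_finsetSum _ fun a _ => hint a b,
      ← Finset.sum_sub_distrib, projTrace, Matrix.trace]
    refine Finset.sum_congr rfl fun b _ => ?_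
    rw [integral_finsetSum _ fun a _ => hint a b, ← Finset.sum_sub_distrib, Matrix.diag_apply,
      Matrix.mul_apply]
    refine Finset.sum_congr rfl fun a _ => ?_
    have hcov : phiMatrix P x a b = (∫ ω, yvec (x ω) a * yvec (x ω) b ∂P) - μ a * μ b :=
      covariance_eq_sub (hy a) (hy b)
    have hrw : ∀ ω, yvec (x ω) b * (Pm ⊗ₖ Pm) b a * yvec (x ω) a =
        (Pm ⊗ₖ Pm) b a * (yvec (x ω) a * yvec (x ω) b) := fun ω => by ring
    simp only [hrw]
    rw [hcov, integral_const_mul]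
    ring
  have hle : ∫ ω, yvec (x ω) ⬝ᵥ (Pm ⊗ₖ Pm) *ᵥ yvec (x ω) ∂P ≤
      ∫ ω, frobNorm (outer (x ω)) ^ 2 ∂P := by
    refine integral_mono ?_ h2 fun ω => ?_
    · simp only [hquad]
      exact integrable_finsetSum _ fun b _ => integrable_finsetSum _ fun a _ => hint a b
    · rw [← yvec_dotProduct_self]
      exact dotProduct_mulVec_le_of_proj hW.1 hW.2 _
  linarith [dotProduct_mulVec_nonneg_of_proj hW.1 hW.2 μ]

lemma rpow_integral_frobNorm_sq_le_moment [IsProbabilityMeasure P] {κ : ℝ} (hκ : 2 ≤ κ)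
    (h2 : Integrable (fun ω => frobNorm (outer (x ω)) ^ 2) P)
    (hκi : Integrable (fun ω => frobNorm (outer (x ω)) ^ κ) P) :
    (∫ ω, frobNorm (outer (x ω)) ^ 2 ∂P) ^ (κ / 2) ≤ moment P x κ := by
  have hpow : ∀ ω, (frobNorm (outer (x ω)) ^ 2) ^ (κ / 2) = frobNorm (outer (x ω)) ^ κ :=
    fun ω => by
      rw [← Real.rpow_natCast, ← Real.rpow_mul (frobNorm_nonneg _)]
      congr 1
      push_cast
      ring
  have := (convexOn_rpow (p := κ / 2) (by linarith)).map_integral_le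
    (continuousOn_id.rpow_const fun _ _ => Or.inr (by linarith)) isClosed_Ici
    (Filter.Eventually.of_forall fun ω => Set.mem_Ici.2 (sq_nonneg (frobNorm (outer (x ω))))) h2
    (by simpa only [Function.comp_def, hpow] using hκi)
  simpa only [hpow, moment] using this

/-- The empirical covariance matrix of `n` independent copies of `x` has mean `Σ` and total variance
at most `E ‖x xᵀ‖² / n`. -/
lemma integral_frobNorm_empCov_sub_sq_le [IsProbabilityMeasure P] (hx : AEMeasurable x P)
    (h2 : Integrable (fun ω => frobNorm (outer (x ω)) ^ 2) P) {n : ℕ} (hn : 0 < n)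
    {xs : Fin n → Ω → Fin p → ℝ} (hind : iIndepFun xs P)
    (hid : ∀ i, IdentDistrib (xs i) x P P) :
    Integrable (fun ω => frobNorm (empCov (fun i => xs i ω) - covMatrix P x) ^ 2) P ∧
      ∫ ω, frobNorm (empCov (fun i => xs i ω) - covMatrix P x) ^ 2 ∂P ≤
        (∫ ω, frobNorm (outer (x ω)) ^ 2 ∂P) / n := by
  have hn' : (n : ℝ) ≠ 0 := by exact_mod_cast hn.ne'
  have hmem := memLp_outer_apply hx h2
  have hide : ∀ i j k, IdentDistrib (fun ω => outer (xs i ω) j k) (fun ω => outer (x ω) j k) P P :=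
    fun i j k => (hid i).comp (measurable_outer_apply j k)
  have hmemi : ∀ i j k, MemLp (fun ω => outer (xs i ω) j k) 2 P :=
    fun i j k => (hide i j k).memLp_iff.2 (hmem j k)
  have hent : ∀ j k, (fun ω => empCov (fun i => xs i ω) j k) =
      fun ω => (1 / (n : ℝ)) * (∑ i, fun ω => outer (xs i ω) j k) ω := fun j k => by
    ext ω
    simp [empCov, Matrix.sum_apply]
  have hS : ∀ j k, MemLp (fun ω => empCov (fun i => xs i ω) j k) 2 P := fun j k => by
    rw [hent]
    exact (memLp_finsetSum' _ fun i _ => hmemi i j k).const_mul _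
  have hmean : ∀ j k, ∫ ω, empCov (fun i => xs i ω) j k ∂P = covMatrix P x j k := fun j k => by
    rw [hent, integral_const_mul]
    simp only [Finset.sum_apply]
    rw [integral_finsetSum _ fun i _ => (hmemi i j k).integrable one_le_two,
      Finset.sum_congr rfl fun i _ => (hide i j k).integral_eq, covMatrix_apply]
    simp [hn']
  have hvar : ∀ j k, ∫ ω, (empCov (fun i => xs i ω) j k - covMatrix P x j k) ^ 2 ∂P ≤
      (∫ ω, outer (x ω) j k ^ 2 ∂P) / n := fun j k => by
    rw [← hmean, ← variance_eq_integral (hS j k).aemeasurable, hent, variance_const_mul,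
      IndepFun.variance_sum (fun i _ => hmemi i j k) fun i _ i' _ hne =>
        (hind.indepFun hne).comp (measurable_outer_apply j k) (measurable_outer_apply j k),
      Finset.sum_congr rfl fun i _ => (hide i j k).variance_eq]
    have hle := variance_le_expectation_sq (hmem j k).aestronglyMeasurable
    simp only [Pi.pow_apply] at hle
    calc (1 / (n : ℝ)) ^ 2 * ∑ _i : Fin n, variance (fun ω => outer (x ω) j k) P
        = variance (fun ω => outer (x ω) j k) P / n := by
          simp
          field_simp
      _ ≤ _ := by gcongr
  have hint : ∀ j k, Integrable
      (fun ω => (empCov (fun i => xs i ω) j k - covMatrix P x j k) ^ 2) P := fun j k =>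
    ((hS j k).sub (memLp_const (covMatrix P x j k))).integrable_sq
  have hint' : ∀ j k, Integrable (fun ω => outer (x ω) j k ^ 2) P := fun j k =>
    (hmem j k).integrable_sq
  simp only [frobNorm_sq, Matrix.sub_apply]
  refine ⟨integrable_finsetSum _ fun j _ => integrable_finsetSum _ fun k _ => hint j k, ?_⟩
  rw [integral_finsetSum _ fun j _ => integrable_finsetSum _ fun k _ => hint j k,
    integral_finsetSum _ fun j _ => integrable_finsetSum _ fun k _ => hint' j k, Finset.sum_div]
  refine Finset.sum_le_sum fun j _ => ?_
  rw [integral_finsetSum _ fun k _ => hint j k, integral_finsetSum _ fun k _ => hint' j k,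
    Finset.sum_div]
  exact Finset.sum_le_sum fun k _ => hvar j k

/-- Jensen's inequality for the concave function `u ↦ u ^ q`. -/
lemma integrable_rpow_and_integral_rpow_le [IsProbabilityMeasure P] {R : Ω → ℝ} {q : ℝ}
    (hq : 0 < q) (hq1 : q ≤ 1) (hR : ∀ ω, 0 ≤ R ω) (hR2 : Integrable (fun ω => R ω ^ 2) P) :
    Integrable (fun ω => R ω ^ (2 * q)) P ∧
      (∫ ω, R ω ^ (2 * q) ∂P) ^ (1 / q) ≤ ∫ ω, R ω ^ 2 ∂P := by
  have hpow : ∀ ω, R ω ^ (2 * q) = (R ω ^ 2) ^ q := fun ω => by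
    rw [Real.rpow_mul (hR ω), Real.rpow_two]
  simp only [hpow]
  have hi : Integrable (fun ω => (R ω ^ 2) ^ q) P := by
    refine ((integrable_const (1 : ℝ)).add hR2).mono'
      (hR2.aemeasurable.pow_const q).aestronglyMeasurable (Filter.Eventually.of_forall fun ω => ?_)
    rw [Real.norm_of_nonneg (by positivity), Pi.add_apply]
    rcases le_total (R ω ^ 2) 1 with h | h
    · linarith [Real.rpow_le_one (sq_nonneg (R ω)) h hq.le, sq_nonneg (R ω)]
    · have := Real.rpow_le_rpow_of_exponent_le h hq1
      rw [Real.rpow_one] at this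
      linarith
  refine ⟨hi, ?_⟩
  have hJ := (Real.concaveOn_rpow hq.le hq1).le_map_integral
    (continuousOn_id.rpow_const fun _ _ => Or.inr hq.le) isClosed_Ici
    (Filter.Eventually.of_forall fun ω => Set.mem_Ici.2 (sq_nonneg (R ω))) hR2 hi
  calc (∫ ω, (R ω ^ 2) ^ q ∂P) ^ (1 / q) ≤ ((∫ ω, R ω ^ 2 ∂P) ^ q) ^ (1 / q) :=
        Real.rpow_le_rpow (integral_nonneg fun ω => by positivity) hJ (by positivity)
    _ = ∫ ω, R ω ^ 2 ∂P := by
        rw [← Real.rpow_mul (integral_nonneg fun ω => by positivity), mul_one_div_cancel hq.ne',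
          Real.rpow_one]

end Moments

/-! ### Size of the remainder terms -/

section Remainder

variable {ι : Type*} {p : ℕ} {M : Finset ι} {Pm : ι → Matrix (Fin p) (Fin p) ℝ}
  {Phi : Matrix (Fin p × Fin p) (Fin p × Fin p) ℝ}

lemma deltaTilde_nonneg {c β κ q mom : ℝ} (hc : 0 ≤ c) (hmom : 0 ≤ mom)
    (hD : ∀ m ∈ M, 0 ≤ modelDim (Pm m)) : 0 ≤ deltaTilde c β κ q mom M Pm Phi := by
  refine Real.rpow_nonneg (mul_nonneg hc (Real.rpow_nonneg (mul_nonneg hmom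
    (Finset.sum_nonneg fun m hm => ?_)) _)) _
  exact mul_nonneg (Real.rpow_nonneg (Real.sqrt_nonneg _) _) (Real.rpow_nonneg (hD m hm) _)

/-- Each model satisfies `δ_m² D_m ≤ E ‖x xᵀ‖²`, and `E ‖x xᵀ‖ ^ κ ≥ (E ‖x xᵀ‖²) ^ (κ/2)`, so a
single summand `δ_m ^ (-κ) D_m ^ (-(κ/2 - 1 - q)) = (δ_m² D_m) ^ (-(κ/2 - q)) δ_m ^ (-2q) D_m` of
`Δ_κ` already makes `δ_m² Δ_κ` at least `E ‖x xᵀ‖²`. -/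
lemma le_deltaSq_mul_deltaKappa {κ q m2 mom : ℝ} (hq : 0 < q) (hκ : 2 * q ≤ κ) {m : ι}
    (hm : m ∈ M) (hD : ∀ m ∈ M, 1 ≤ modelDim (Pm m)) (hpos : 0 < projTrace (Pm m) Phi)
    (hle : projTrace (Pm m) Phi ≤ m2) (hmom : m2 ^ (κ / 2) ≤ mom) :
    m2 ≤ deltaSq (Pm m) Phi * deltaKappa 1 κ q mom M Pm Phi := by
  set D := modelDim (Pm m) with hDdef
  set d := deltaSq (Pm m) Phi with hddef
  have hD1 : 1 ≤ D := hD m hm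
  have hD0 : 0 < D := by linarith
  have hdD : d * D = projTrace (Pm m) Phi := deltaSq_mul_modelDim Phi hD1
  have hd : 0 < d := div_pos hpos hD0
  have hm2 : 0 < m2 := hpos.trans_le hle
  have hmom0 : 0 < mom := (Real.rpow_pos_of_pos hm2 _).trans_le hmom
  set f : ι → ℝ := fun m => Real.sqrt (deltaSq (Pm m) Phi) ^ (-κ) *
    modelDim (Pm m) ^ (-(κ / 2 - 1 - q)) with hf
  have hf0 : ∀ m ∈ M, 0 ≤ f m := fun m hm =>
    mul_nonneg (Real.rpow_nonneg (Real.sqrt_nonneg _) _)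
      (Real.rpow_nonneg (by linarith [hD m hm]) _)
  have hfm : f m = (d * D) ^ (-(κ / 2 - q)) * D * d ^ (-q) := by
    have h1 : Real.sqrt d ^ (-κ) = d ^ (-(κ / 2 - q)) * d ^ (-q) := by
      rw [Real.sqrt_eq_rpow, ← Real.rpow_mul hd.le, ← Real.rpow_add hd]
      congr 1
      ring
    have h2 : D ^ (-(κ / 2 - 1 - q)) = D ^ (-(κ / 2 - q)) * D := by
      rw [← Real.rpow_add_one hD0.ne']
      congr 1
      ring
    simp only [hf]
    rw [← hddef, ← hDdef, h1, h2, Real.mul_rpow hd.le hD0.le]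
    ring
  have hsum : d ^ (-q) * m2 ^ q ≤ 1 * mom * ∑ m ∈ M, f m := by
    calc d ^ (-q) * m2 ^ q = m2 ^ (κ / 2) * (m2 ^ (-(κ / 2 - q)) * 1 * d ^ (-q)) := by
          have : m2 ^ q = m2 ^ (κ / 2) * m2 ^ (-(κ / 2 - q)) := by
            rw [← Real.rpow_add hm2]
            congr 1
            ring
          rw [this]
          ring
      _ ≤ mom * ((d * D) ^ (-(κ / 2 - q)) * D * d ^ (-q)) := by
          gcongr ?_ * (?_ * ?_ * _)
          exact Real.rpow_le_rpow_of_nonpos (by positivity) (hdD ▸ hle) (by linarith)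
      _ = mom * f m := by rw [hfm]
      _ ≤ 1 * mom * ∑ m ∈ M, f m := by
          rw [one_mul]
          gcongr
          exact Finset.single_le_sum hf0 hm
  calc m2 = d * (d ^ (-q) * m2 ^ q) ^ (1 / q) := by
        rw [Real.mul_rpow (by positivity) (by positivity), ← Real.rpow_mul hd.le,
          ← Real.rpow_mul hm2.le, mul_one_div_cancel hq.ne', Real.rpow_one, neg_mul,
          mul_one_div_cancel hq.ne', Real.rpow_neg_one]
        field_simp
    _ ≤ d * deltaKappa 1 κ q mom M Pm Phi := by
        rw [deltaKappa]
        gcongr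

end Remainder

/-! ### Measurability of the selected loss -/

lemma aemeasurable_finite_selection {Ω ι : Type*} [MeasurableSpace Ω] {P : Measure Ω}
    {M : Finset ι} {sel : Ω → ι} (hsel : ∀ m ∈ M, NullMeasurableSet {ω | sel ω = m} P)
    (hmem : ∀ ω, sel ω ∈ M) {f : ι → Ω → ℝ} (hf : ∀ m ∈ M, AEMeasurable (f m) P) :
    AEMeasurable (fun ω => f (sel ω) ω) P := by
  classical
  have h : (fun ω => f (sel ω) ω) =
      fun ω => ∑ m ∈ M, {ω | sel ω = m}.indicator (f m) ω := by
    ext ω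
    rw [Finset.sum_eq_single_of_mem (sel ω) (hmem ω)
      fun m _ hne => Set.indicator_of_notMem (fun h => hne h.symm) _,
      Set.indicator_of_mem (by simp)]
  rw [h]
  exact Finset.aemeasurable_fun_sum _ fun m hm => (hf m hm).indicator₀ (hsel m hm)

lemma measurable_frobNorm_sub_projEstimator {p n : ℕ} (Sig Q : Matrix (Fin p) (Fin p) ℝ) :
    Measurable fun x : Fin n → Fin p → ℝ => frobNorm (Sig - projEstimator x Q) := by
  refine Continuous.measurable ?_
  unfold frobNorm projEstimator empCov outer
  fun_prop

end CovSelection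

/-! ### The oracle inequality -/

open CovSelection in
theorem theorem2 :
    -- `C θ β q`, `c θ β q`, `C' θ κ q` are the constants; `n₀ β θ C_inf p Σ` is the threshold.
    ∃ (C c C' : ℝ → ℝ → ℝ → ℝ)
      (n₀ : ℝ → ℝ → ℝ → (p : ℕ) → Matrix (Fin p) (Fin p) ℝ → ℕ),
      (∀ a b d : ℝ, 0 < C a b d ∧ 0 < c a b d ∧ 0 < C' a b d) ∧
      ∀ (θ β q : ℝ), 0 < θ → 0 < q → q ≤ 1 → max (2 * (1 + 2 * q)) (3 + 2 * q) < β →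
      -- the process `X`, its observation points, and the models
      ∀ {Ω : Type*} [MeasurableSpace Ω] (P : Measure Ω) [IsProbabilityMeasure P]
        {T : Type*} {p : ℕ} (t : Fin p → T) (X : T → Ω → ℝ)
        {Λ : Type*} (g : Λ → T → ℝ) (M : Finset (Finset Λ)) (hM : M.Nonempty)
        (H : (m : Finset Λ) → Matrix m m ℝ),
      (∀ m ∈ M, IsReflexiveGenInverse ((designMatrix g t m)ᵀ * designMatrix g t m) (H m)) →
      AEMeasurable (obs t X) P →
      (∀ j, ∫ ω, X (t j) ω ∂P = 0) →
      Integrable (fun ω => frobNorm (outer (obs t X ω)) ^ β) P →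
      let Pm : Finset Λ → Matrix (Fin p) (Fin p) ℝ := fun m => projMatrix g t m (H m)
      let Sig : Matrix (Fin p) (Fin p) ℝ := covMatrix P (obs t X)
      let Phi : Matrix (Fin p × Fin p) (Fin p × Fin p) ℝ := phiMatrix P (obs t X)
      let Cinf : ℝ := M.inf' hM fun m => projTrace (Pm m) Phi
      0 < Cinf →
      -- the sample of size `n`, and the selected model
      ∀ (n : ℕ), n₀ β θ Cinf p Sig ≤ n →
      ∀ (Xs : Fin n → T → Ω → ℝ),
      iIndepFun (fun i => obs t (Xs i)) P →
      (∀ i, IdentDistrib (obs t (Xs i)) (obs t X) P P) →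
      ∀ (mSel : Ω → Finset Λ),
      (∀ m ∈ M, NullMeasurableSet {ω | mSel ω = m} P) →
      (∀ ω, mSel ω ∈ M ∧ ∀ m ∈ M,
        penCrit θ (fun i => obs t (Xs i) ω) (Pm (mSel ω)) ≤
          penCrit θ (fun i => obs t (Xs i) ω) (Pm m)) →
      let SigSel : Ω → Matrix (Fin p) (Fin p) ℝ :=
        fun ω => projEstimator (fun i => obs t (Xs i) ω) (Pm (mSel ω))
      Integrable (fun ω => frobNorm (Sig - SigSel ω) ^ (2 * q)) P ∧
      ∀ κ : ℝ, 2 * (1 + 2 * q) < κ → κ < min β (2 * β - 4) →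
        (∫ ω, frobNorm (Sig - SigSel ω) ^ (2 * q) ∂P) ^ (1 / q) ≤
          C θ β q * M.inf' hM (fun m => oracleRisk n Sig Phi (Pm m)) +
          C θ β q / n *
            (deltaTilde (c θ β q) β κ q (moment P (obs t X) β) M Pm Phi *
                (moment P (obs t X) β ^ (2 / β) + frobNorm Sig ^ 2) +
              M.sup' hM (fun m => deltaSq (Pm m) Phi) *
                deltaKappa (C' θ κ q) κ q (moment P (obs t X) κ) M Pm Phi) := by
  refine ⟨fun a _ _ => 8 + 2 * |a|, fun _ _ _ => 1, fun _ _ _ => 1, fun _ _ _ _ _ => 1,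
    fun a b d => ⟨by positivity, one_pos, one_pos⟩, ?_⟩
  intro θ β q hθ hq hq1 hβ Ω _ P _ T p t X Λ g M hM H hH hx _ hβi Pm Sig Phi Cinf hC n hn Xs hind
    hid mSel hsel hmin SigSel
  have hn0 : 0 < n := hn
  have hn' : (0 : ℝ) < n := by exact_mod_cast hn0
  have hβ2 : 2 * (1 + 2 * q) < β := (le_max_left _ _).trans_lt hβ
  have hproj : ∀ m ∈ M, (Pm m)ᵀ = Pm m ∧ Pm m * Pm m = Pm m :=
    fun m hm => projMatrix_isProj g t m (H m) (hH m hm)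
  have hpos : ∀ m ∈ M, 0 < projTrace (Pm m) Phi :=
    fun m hm => hC.trans_le (Finset.inf'_le _ hm)
  have hD : ∀ m ∈ M, 1 ≤ modelDim (Pm m) :=
    fun m hm => one_le_modelDim (hproj m hm).1 (hproj m hm).2 (hpos m hm)
  have h2 : Integrable (fun ω => frobNorm (outer (obs t X ω)) ^ 2) P := by
    simpa using integrable_frobNorm_rpow hx hβi (r := 2) (by norm_num) (by linarith)
  set m2 := ∫ ω, frobNorm (outer (obs t X ω)) ^ 2 ∂P with hm2
  have hide : ∀ i, IdentDistrib (fun ω => frobNorm (outer (obs t (Xs i) ω)) ^ 2)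
      (fun ω => frobNorm (outer (obs t X ω)) ^ 2) P P :=
    fun i => (hid i).comp (measurable_frobNorm_outer.pow_const 2)
  obtain ⟨hSi, hSle⟩ := integral_frobNorm_empCov_sub_sq_le hx h2 hn0 hind hid
  -- the model that minimizes the risk bound
  obtain ⟨m₀, hm₀, hinf⟩ := Finset.exists_mem_eq_inf' hM fun m => oracleRisk n Sig Phi (Pm m)
  set B := frobNorm (Sig - Pm m₀ * Sig * Pm m₀) ^ 2 with hB
  set U : Ω → ℝ := fun ω => 6 * frobNorm (empCov (fun i => obs t (Xs i) ω) - Sig) ^ 2 + 4 * B +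
    2 * ((1 + θ) * ((1 / (n : ℝ)) * (∑ i, frobNorm (outer (obs t (Xs i) ω)) ^ 2) / n)) with hU
  have hpath : ∀ ω, frobNorm (Sig - SigSel ω) ^ 2 ≤ U ω := fun ω =>
    frobNorm_sub_selected_sq_le hθ hn0 _ Sig (hproj m₀ hm₀).1 (hproj m₀ hm₀).2 (hD m₀ hm₀)
      (hproj _ (hmin ω).1).1 (hproj _ (hmin ω).1).2 (hD _ (hmin ω).1) ((hmin ω).2 m₀ hm₀)
  have hsumi : Integrable (fun ω => ∑ i, frobNorm (outer (obs t (Xs i) ω)) ^ 2) P :=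
    integrable_finsetSum _ fun i _ => (hide i).integrable_iff.2 h2
  have hsum : ∫ ω, ∑ i, frobNorm (outer (obs t (Xs i) ω)) ^ 2 ∂P = n * m2 := by
    rw [integral_finsetSum _ fun i _ => (hide i).integrable_iff.2 h2,
      Finset.sum_congr rfl fun i _ => (hide i).integral_eq]
    simp [hm2]
  have hUi1 : Integrable (fun ω => 6 * frobNorm (empCov (fun i => obs t (Xs i) ω) - Sig) ^ 2 +
      4 * B) P := (hSi.const_mul 6).add (integrable_const _)
  have hUi2 : Integrable (fun ω => 2 * ((1 + θ) * ((1 / (n : ℝ)) *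
      (∑ i, frobNorm (outer (obs t (Xs i) ω)) ^ 2) / n))) P :=
    (((hsumi.const_mul _).div_const _).const_mul _).const_mul _
  have hUi : Integrable U P := hUi1.add hUi2
  have hUint : ∫ ω, U ω ∂P ≤ 4 * B + (8 + 2 * θ) / n * m2 := by
    rw [hU, integral_add hUi1 hUi2, integral_add (hSi.const_mul 6) (integrable_const _),
      integral_const_mul, integral_const, integral_const_mul, integral_const_mul, integral_div,
      integral_const_mul, hsum, probReal_univ, one_smul]
    have h3 : 2 * ((1 + θ) * (1 / (n : ℝ) * (n * m2) / n)) = (2 + 2 * θ) * (m2 / n) := by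
      field_simp
    have h4 : (8 + 2 * θ) / n * m2 = (8 + 2 * θ) * (m2 / n) := by ring
    rw [h3, h4]
    linarith
  have hloss : AEMeasurable (fun ω => frobNorm (Sig - SigSel ω)) P :=
    aemeasurable_finite_selection hsel (fun ω => (hmin ω).1)
      (f := fun m ω => frobNorm (Sig - projEstimator (fun i => obs t (Xs i) ω) (Pm m)))
      fun m _ => (measurable_frobNorm_sub_projEstimator Sig (Pm m)).comp_aemeasurable
        (aemeasurable_pi_lambda _ fun i => (hid i).aemeasurable_fst)
  have hlossi : Integrable (fun ω => frobNorm (Sig - SigSel ω) ^ 2) P :=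
    hUi.mono' (hloss.pow_const 2).aestronglyMeasurable (Filter.Eventually.of_forall fun ω => by
      rw [Real.norm_of_nonneg (sq_nonneg _)]
      exact hpath ω)
  obtain ⟨hqi, hqle⟩ :=
    integrable_rpow_and_integral_rpow_le hq hq1 (fun ω => frobNorm_nonneg _) hlossi
  refine ⟨hqi, fun κ hκ hκβ => ?_⟩
  have hκβ' : κ ≤ β := (hκβ.trans_le (min_le_left _ _)).le
  have hmomκ := rpow_integral_frobNorm_sq_le_moment (by linarith) h2
    (integrable_frobNorm_rpow hx hβi (r := κ) (by linarith) hκβ')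
  have hmom0 : ∀ r, 0 ≤ moment P (obs t X) r := fun r =>
    integral_nonneg fun ω => Real.rpow_nonneg (frobNorm_nonneg _) _
  have hrem : m2 ≤ M.sup' hM (fun m => deltaSq (Pm m) Phi) *
      deltaKappa 1 κ q (moment P (obs t X) κ) M Pm Phi := by
    refine (le_deltaSq_mul_deltaKappa hq (by linarith) hm₀ hD (hpos m₀ hm₀)
      (projTrace_phiMatrix_le hx h2 (hproj m₀ hm₀).1 (hproj m₀ hm₀).2) hmomκ).trans ?_
    refine mul_le_mul_of_nonneg_right
      (Finset.le_sup' (fun m => deltaSq (Pm m) Phi) hm₀) (Real.rpow_nonneg ?_ _)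
    refine mul_nonneg (by simpa using hmom0 κ) (Finset.sum_nonneg fun m hm => ?_)
    exact mul_nonneg (Real.rpow_nonneg (Real.sqrt_nonneg _) _)
      (Real.rpow_nonneg (by linarith [hD m hm]) _)
  have htilde : 0 ≤ deltaTilde 1 β κ q (moment P (obs t X) β) M Pm Phi *
      (moment P (obs t X) β ^ (2 / β) + frobNorm Sig ^ 2) :=
    mul_nonneg (deltaTilde_nonneg zero_le_one (hmom0 β) fun m hm => by linarith [hD m hm])
      (add_nonneg (Real.rpow_nonneg (hmom0 β) _) (sq_nonneg _))
  have hBle : B ≤ oracleRisk n Sig Phi (Pm m₀) := by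
    rw [oracleRisk, deltaSq_mul_modelDim _ (hD m₀ hm₀)]
    exact le_add_of_nonneg_right (div_nonneg (hpos m₀ hm₀).le hn'.le)
  simp only [hinf, abs_of_pos hθ]
  calc (∫ ω, frobNorm (Sig - SigSel ω) ^ (2 * q) ∂P) ^ (1 / q)
      ≤ ∫ ω, frobNorm (Sig - SigSel ω) ^ 2 ∂P := hqle
    _ ≤ ∫ ω, U ω ∂P := integral_mono hlossi hUi hpath
    _ ≤ 4 * B + (8 + 2 * θ) / n * m2 := hUint
    _ ≤ _ := by
      -- the bias is absorbed by the oracle risk, and the rest by the second remainder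
      gcongr ?_ * ?_ + (8 + 2 * θ) / n * ?_
      · linarith
      · linarith
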